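/- Let $n\ge 1$ be an integer and let $a,b$ be integers with $b\ge 0$. Let $K_n^{ab}$ be the integral gain graph on the vertex set $\{1,\dots,n\}$ which has, for each pair $i<j$ and each integer $k$ with $a\le k\le b$, exactly one edge from $i$ to $j$ with gain $k$ (gain $-k$ when the edge is traversed from $j$ to $i$). Let $\mathcal A[K_n^{ab}]$ be the corresponding affinographic hyperplane arrangement in $\mathbb R^n$, that is, the set of all hyperplanes $x_j-x_i=k$ with $1\le i<j\le n$ and $k\in\mathbb Z$, $a\le k\le b$. A region of the arrangement is a connected component of the complement in $\mathbb R^n$ of the union of its hyperplanes. Then the number of regions of $\mathcal A[K_n^{ab}]$ is finite in both of the following cases, and it equals $$(bn+2)(bn+3)\cdots(bn+n)\qquad\text{if } a+b=0$$ (an empty product, equal to $1$, when $n=1$), and $$(bn+1)^{n-1}\qquad\text{if } a+b=1.$$ -/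

import Mathlib

/-- An integral gain graph on the vertex set `V`: a loopless multigraph whose edges carry integer
gains.  Every edge is stored in one reference orientation, from `tail` to `head`; in the opposite
orientation its gain is negated (see `IntegralGainGraph.HasEdge`). -/
structure IntegralGainGraph (V : Type) where
  /-- the edges -/
  Edge : Type
  /-- the start of an edge in its reference orientation -/
  tail : Edge → V
  /-- the end of an edge in its reference orientation -/
  head : Edge → V
  /-- the gain of an edge in its reference orientation -/
  gain : Edge → ℤ
  /-- there are no loops -/
  tail_ne_head : ∀ e, tail e ≠ head e

/-- `Φ.HasEdge g i j`: there is an edge of `Φ` with endpoints `i` and `j` whose gain is `g` when it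
is oriented from `i` to `j`. -/
def IntegralGainGraph.HasEdge {V : Type} (Φ : IntegralGainGraph V) (g : ℤ) (i j : V) : Prop :=
  ∃ e : Φ.Edge, (Φ.tail e = i ∧ Φ.head e = j ∧ Φ.gain e = g) ∨
    (Φ.tail e = j ∧ Φ.head e = i ∧ Φ.gain e = -g)

/-- The affinographic hyperplane arrangement of an integral gain graph on `n` ordered vertices: the
set of all hyperplanes `x_j - x_i = g` of `ℝⁿ`, for the edges from `i` to `j` with `i < j` and
gain `g`. -/
def IntegralGainGraph.arrangement {n : ℕ} (Φ : IntegralGainGraph (Fin n)) :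
    Set (Set (Fin n → ℝ)) :=
  {H | ∃ (i j : Fin n) (g : ℤ), i < j ∧ Φ.HasEdge g i j ∧ H = {x | x j - x i = (g : ℝ)}}

/-- The gain graph `K_n^{ab}`: for each pair of vertices `i < j` and each integer `k` with
`a ≤ k ≤ b` there is exactly one edge from `i` to `j` with gain `k`. -/
def completeGainGraph (n : ℕ) (a b : ℤ) : IntegralGainGraph (Fin n) where
  Edge := {e : Fin n × Fin n × ℤ // e.1 < e.2.1 ∧ a ≤ e.2.2 ∧ e.2.2 ≤ b}
  tail e := e.1.1
  head e := e.1.2.1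
  gain e := e.1.2.2
  tail_ne_head e := ne_of_lt e.2.1

/-- The regions of an arrangement of hyperplanes in `ℝⁿ`: the connected components of the complement
of the union of the hyperplanes. -/
abbrev ArrangementRegion {n : ℕ} (A : Set (Set (Fin n → ℝ))) : Type :=
  ConnectedComponents ((⋃₀ A)ᶜ : Set (Fin n → ℝ))

/-! This is the finite field method. Deleting and contracting an edge changes the number of
potentials modulo large `q` that avoid all edges, and the number of regions, by the same recursion
up to a sign; the sign is absorbed because contraction loses one vertex. Hence one polynomial `p`
gives the first number as `p(q)` and the second as `(-1)^n p(-1)` (`exists_charPoly`). Regions are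
counted through sign patterns.

To find `p`, put `c = a + b`, which is 0 or 1, and view a potential as labels on a cycle of length
`q`, rotated so that the last label is at 0. When `c ≤ b`, avoidance says that the gap between
cyclic neighbours exceeds `b` if the label increases and `b - c` if it decreases. Removing `b` units
from each of the `n` gaps (`ncard_separatedPositions`) leaves labels on a cycle of length `M = q -
bn`: distinct if `c = 0`, arbitrary if `c = 1`, coinciding labels being read in decreasing order. If
`u(M)` counts these placements (a falling factorial or `M^n`), undoing the rotations gives `p(q) / q
= u(M) / M`. At `q = -1`, `M = -(bn + 1)`, and both formulas follow. -/

open Polynomial Filter Topology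

/-! ### Sign patterns -/

/-- The defect `x_j - x_i - g` of the potential `x` along the edge `(i, j, g)`. -/
def edgeDefect {V R : Type} [CommRing R] (e : V × V × ℤ) (x : V → R) : R :=
  x e.2.1 - x e.1 - (e.2.2 : R)

/-- The potentials satisfying none of the equations `x_j - x_i = g` for the edges in `E`. -/
def avoidSet {V : Type} (R : Type) [CommRing R] (E : List (V × V × ℤ)) : Set (V → R) :=
  {x | ∀ e ∈ E, edgeDefect e x ≠ 0}

/-- The list of sides of the hyperplanes of `E` on which `x` lies. -/
noncomputable def signPattern {V : Type} (E : List (V × V × ℤ)) (x : V → ℝ) : List Bool :=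
  E.map fun e => decide (0 < edgeDefect e x)

theorem signPattern_eq_iff {V : Type} {E : List (V × V × ℤ)} {x y : V → ℝ} :
    signPattern E x = signPattern E y ↔
      ∀ e ∈ E, (0 < edgeDefect e x ↔ 0 < edgeDefect e y) := by
  simp [signPattern, List.map_inj_left]

theorem finite_signPatterns {V : Type} (E : List (V × V × ℤ)) (S : Set (V → ℝ)) :
    (signPattern E '' S).Finite := by
  refine (List.finite_length_eq Bool E.length).subset ?_
  rintro _ ⟨x, -, rfl⟩
  simp [signPattern]

theorem edgeDefect_convexComb {V : Type} (e : V × V × ℤ) (x y : V → ℝ) {a b : ℝ}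
    (hab : a + b = 1) :
    edgeDefect e (a • x + b • y) = a * edgeDefect e x + b * edgeDefect e y := by
  simp only [edgeDefect, Pi.add_apply, Pi.smul_apply, smul_eq_mul]
  linear_combination (e.2.2 : ℝ) * hab

theorem convexComb_mem_avoidSet {V : Type} {E : List (V × V × ℤ)} {x y : V → ℝ}
    (hx : x ∈ avoidSet ℝ E) (hy : y ∈ avoidSet ℝ E) (hxy : signPattern E x = signPattern E y)
    {a b : ℝ} (ha : 0 ≤ a) (hb : 0 ≤ b) (hab : a + b = 1) :
    a • x + b • y ∈ avoidSet ℝ E ∧ signPattern E (a • x + b • y) = signPattern E x := by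
  have key : ∀ e ∈ E, edgeDefect e (a • x + b • y) ≠ 0 ∧
      (0 < edgeDefect e (a • x + b • y) ↔ 0 < edgeDefect e x) := by
    intro e he
    have h := signPattern_eq_iff.1 hxy e he
    rw [edgeDefect_convexComb e x y hab]
    rcases lt_or_gt_of_ne (hx e he) with h1 | h1
    · have h2 : edgeDefect e y < 0 :=
        lt_of_le_of_ne (not_lt.1 fun h3 => h1.not_gt (h.2 h3)) (hy e he)
      have : a * edgeDefect e x + b * edgeDefect e y < 0 := by
        rcases ha.eq_or_lt with rfl | ha
        · rw [zero_add] at hab; subst hab; simpa using h2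
        · have := mul_neg_of_pos_of_neg ha h1
          have := mul_nonpos_of_nonneg_of_nonpos hb h2.le
          linarith
      exact ⟨this.ne, iff_of_false this.not_gt h1.not_gt⟩
    · have h2 := h.1 h1
      have : 0 < a * edgeDefect e x + b * edgeDefect e y := by
        rcases ha.eq_or_lt with rfl | ha
        · rw [zero_add] at hab; subst hab; simpa using h2
        · have := mul_pos ha h1
          have := mul_nonneg hb h2.le
          linarith
      exact ⟨this.ne', iff_of_true this h1⟩
  exact ⟨fun e he => (key e he).1, signPattern_eq_iff.2 fun e he => (key e he).2⟩

theorem continuous_edgeDefect {V : Type} (e : V × V × ℤ) :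
    Continuous fun x : V → ℝ => edgeDefect e x := by
  unfold edgeDefect; fun_prop

theorem eventually_signPattern_eq {V : Type} (E : List (V × V × ℤ)) {x : V → ℝ}
    (hx : x ∈ avoidSet ℝ E) :
    ∀ᶠ y in 𝓝 x, y ∈ avoidSet ℝ E ∧ signPattern E y = signPattern E x := by
  have h : ∀ e ∈ E, ∀ᶠ y in 𝓝 x, edgeDefect e y ≠ 0 ∧
      (0 < edgeDefect e y ↔ 0 < edgeDefect e x) := by
    intro e he
    have hc := (continuous_edgeDefect e).continuousAt (x := x)
    rcases lt_or_gt_of_ne (hx e he) with h1 | h1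
    · filter_upwards [hc.eventually_lt_const h1] with y hy
      exact ⟨hy.ne, iff_of_false hy.not_gt h1.not_gt⟩
    · filter_upwards [hc.eventually_const_lt h1] with y hy
      exact ⟨hy.ne', iff_of_true hy h1⟩
  classical
  have h' : ∀ᶠ y in 𝓝 x, ∀ e ∈ E.toFinset, edgeDefect e y ≠ 0 ∧
      (0 < edgeDefect e y ↔ 0 < edgeDefect e x) := by
    exact (Finset.eventually_all _).2 fun e he => h e (List.mem_toFinset.1 he)
  filter_upwards [h'] with y hy
  simp only [List.mem_toFinset] at hy
  exact ⟨fun e he => (hy e he).1, signPattern_eq_iff.2 fun e he => (hy e he).2⟩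

/-! ### Deletion and contraction -/

section Contraction

variable {V R : Type} [DecidableEq V] [CommRing R] {i j : V}

/-- The projection of the vertices along the contraction of an edge from `i` to `j`. -/
def contractVertex (hij : i ≠ j) (v : V) : {v : V // v ≠ j} :=
  if h : v = j then ⟨i, hij⟩ else ⟨v, h⟩

/-- The offset of a vertex over its image under the contraction. -/
def contractOffset (j : V) (g : ℤ) (v : V) : ℤ := if v = j then g else 0

/-- The image of an edge under the contraction of an edge from `i` to `j` with gain `g`. -/
def contractEdge (hij : i ≠ j) (g : ℤ) (e : V × V × ℤ) :
    {v : V // v ≠ j} × {v : V // v ≠ j} × ℤ :=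
  (contractVertex hij e.1, contractVertex hij e.2.1,
    e.2.2 + contractOffset j g e.1 - contractOffset j g e.2.1)

/-- The potential on `V` induced by a potential on the contraction. -/
def liftPotential (hij : i ≠ j) (g : ℤ) (y : {v : V // v ≠ j} → R) (v : V) : R :=
  y (contractVertex hij v) + (contractOffset j g v : ℤ)

theorem edgeDefect_liftPotential (hij : i ≠ j) (g : ℤ) (y : {v : V // v ≠ j} → R)
    (e : V × V × ℤ) :
    edgeDefect e (liftPotential hij g y) = edgeDefect (contractEdge hij g e) y := by
  simp only [edgeDefect, liftPotential, contractEdge]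
  push_cast
  ring

theorem liftPotential_injective (hij : i ≠ j) (g : ℤ) :
    Function.Injective (liftPotential (R := R) hij g) := by
  intro y z h
  ext ⟨v, hv⟩
  have := congrFun h v
  simpa [liftPotential, contractVertex, contractOffset, hv] using this

/-- Identifies the contracted arrangement with the restriction of `E` to the hyperplane of the
contracted edge. -/
theorem image_liftPotential (hij : i ≠ j) (g : ℤ) (E : List (V × V × ℤ)) :
    liftPotential hij g '' avoidSet R (E.map (contractEdge hij g)) =
      {x | x ∈ avoidSet R E ∧ edgeDefect (i, j, g) x = 0} := by
  ext x
  constructor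
  · rintro ⟨y, hy, rfl⟩
    refine ⟨fun e he => ?_, ?_⟩
    · rw [edgeDefect_liftPotential]
      exact hy _ (List.mem_map_of_mem he)
    · simp [edgeDefect, liftPotential, contractVertex, contractOffset, hij]
  · rintro ⟨hx, h0⟩
    have hl : liftPotential hij g (fun v => x v.1) = x := by
      ext v
      by_cases hv : v = j
      · subst hv
        simp only [edgeDefect] at h0
        simp only [liftPotential, contractVertex, contractOffset, dif_pos, if_pos]
        linear_combination -h0
      · simp [liftPotential, contractVertex, contractOffset, hv]
    refine ⟨fun v => x v.1, ?_, hl⟩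
    intro e he
    obtain ⟨e, he', rfl⟩ := List.mem_map.1 he
    rw [← edgeDefect_liftPotential, hl]
    exact hx e he'

theorem signPattern_liftPotential (hij : i ≠ j) (g : ℤ) (E : List (V × V × ℤ))
    (y : {v : V // v ≠ j} → ℝ) :
    signPattern E (liftPotential hij g y) = signPattern (E.map (contractEdge hij g)) y := by
  simp [signPattern, edgeDefect_liftPotential, Function.comp_def]

theorem ncard_avoidSet_deletion [Finite V] [Finite R] (hij : i ≠ j) (g : ℤ)
    (E : List (V × V × ℤ)) :
    (avoidSet R E).ncard = (avoidSet R ((i, j, g) :: E)).ncard +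
      (avoidSet R (E.map (contractEdge hij g))).ncard := by
  rw [← Set.ncard_image_of_injective _ (liftPotential_injective hij g), image_liftPotential,
    ← Set.ncard_union_eq]
  · congr 1
    ext x
    simp only [avoidSet, List.mem_cons, forall_eq_or_imp, Set.mem_union, Set.mem_ofPred_eq]
    tauto
  · rw [Set.disjoint_left]
    rintro x hx ⟨-, h⟩
    exact hx _ List.mem_cons_self h

/-- With `A` and `B` the patterns of `E` realised on the two sides of the new hyperplane, the left
side is `|A| + |B| = |A ∪ B| + |A ∩ B|`. The patterns in `A ∩ B` are those of the regions cut by the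
hyperplane, that is, those of the contraction. -/
theorem ncard_signPatterns_deletion (hij : i ≠ j) (g : ℤ) (E : List (V × V × ℤ)) :
    (signPattern ((i, j, g) :: E) '' avoidSet ℝ ((i, j, g) :: E)).ncard =
      (signPattern E '' avoidSet ℝ E).ncard +
      (signPattern (E.map (contractEdge hij g)) ''
        avoidSet ℝ (E.map (contractEdge hij g))).ncard := by
  set f : (V → ℝ) → ℝ := edgeDefect (i, j, g) with hf
  set A := signPattern E '' {x | x ∈ avoidSet ℝ E ∧ 0 < f x} with hA
  set B := signPattern E '' {x | x ∈ avoidSet ℝ E ∧ f x < 0} with hB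
  have hfin : ∀ S, (signPattern E '' S).Finite := finite_signPatterns E
  have hmove : ∀ x (t : ℝ), f (x + t • Pi.single j 1) = f x + t := by
    intro x t
    simp [hf, edgeDefect, hij]
    ring
  -- A small move of coordinate `j` in either direction leaves the hyperplane without changing the
  -- pattern.
  have hpert : ∀ x ∈ avoidSet ℝ E, f x = 0 → signPattern E x ∈ A ∩ B := by
    intro x hx h0
    have hc : Tendsto (fun t : ℝ => x + t • (Pi.single j 1 : V → ℝ)) (𝓝 0) (𝓝 x) := by
      have : Continuous fun t : ℝ => x + t • (Pi.single j 1 : V → ℝ) := by fun_prop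
      simpa using this.tendsto 0
    have he := hc.eventually (eventually_signPattern_eq E hx)
    obtain ⟨t, ⟨ht1, ht2⟩, ht⟩ :=
      ((he.filter_mono nhdsWithin_le_nhds).and (self_mem_nhdsWithin (s := Set.Ioi (0 : ℝ)))).exists
    obtain ⟨u, ⟨hu1, hu2⟩, hu⟩ :=
      ((he.filter_mono nhdsWithin_le_nhds).and (self_mem_nhdsWithin (s := Set.Iio (0 : ℝ)))).exists
    refine ⟨⟨_, ⟨ht1, ?_⟩, ht2⟩, ⟨_, ⟨hu1, ?_⟩, hu2⟩⟩
    · rw [hmove, h0, zero_add]; exact ht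
    · rw [hmove, h0, zero_add]; exact hu
  have h1 : signPattern ((i, j, g) :: E) '' avoidSet ℝ ((i, j, g) :: E) =
      List.cons true '' A ∪ List.cons false '' B := by
    ext s
    constructor
    · rintro ⟨x, hx, rfl⟩
      have hx' : x ∈ avoidSet ℝ E := fun e he => hx e (List.mem_cons_of_mem _ he)
      rcases lt_or_gt_of_ne (hx _ List.mem_cons_self) with h | h
      · exact Or.inr ⟨_, ⟨x, ⟨hx', h⟩, rfl⟩, by simp [signPattern, h.le]⟩
      · exact Or.inl ⟨_, ⟨x, ⟨hx', h⟩, rfl⟩, by simp [signPattern, h]⟩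
    · rintro (⟨_, ⟨x, ⟨hx, h⟩, rfl⟩, rfl⟩ | ⟨_, ⟨x, ⟨hx, h⟩, rfl⟩, rfl⟩)
      · exact ⟨x, List.forall_mem_cons.2 ⟨h.ne', hx⟩, by simpa [signPattern] using h⟩
      · exact ⟨x, List.forall_mem_cons.2 ⟨h.ne, hx⟩, by simpa [signPattern] using h.le⟩
  have h2 : signPattern E '' avoidSet ℝ E = A ∪ B := by
    ext s
    constructor
    · rintro ⟨x, hx, rfl⟩
      rcases lt_trichotomy (f x) 0 with h | h | h
      · exact Or.inr ⟨x, ⟨hx, h⟩, rfl⟩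
      · exact Or.inl (hpert x hx h).1
      · exact Or.inl ⟨x, ⟨hx, h⟩, rfl⟩
    · rintro (⟨x, ⟨hx, -⟩, rfl⟩ | ⟨x, ⟨hx, -⟩, rfl⟩) <;> exact ⟨x, hx, rfl⟩
  have h3 : signPattern (E.map (contractEdge hij g)) ''
      avoidSet ℝ (E.map (contractEdge hij g)) = A ∩ B := by
    have : signPattern (E.map (contractEdge hij g)) = signPattern E ∘ liftPotential hij g := by
      ext1 y
      exact (signPattern_liftPotential hij g E y).symm
    rw [this, Set.image_comp, image_liftPotential]
    ext s
    constructor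
    · rintro ⟨x, ⟨hx, h⟩, rfl⟩
      exact hpert x hx h
    · rintro ⟨⟨x, ⟨hx, hfx⟩, rfl⟩, ⟨y, ⟨hy, hfy⟩, hxy⟩⟩
      -- These weights place the convex combination at the zero of `f` on the segment from `x` to
      -- `y`.
      have hpos : 0 < f x - f y := by linarith
      have hab : -f y / (f x - f y) + f x / (f x - f y) = 1 := by
        field_simp; ring
      obtain ⟨h1, h2⟩ := convexComb_mem_avoidSet hx hy hxy.symm
        (div_nonneg (neg_nonneg.2 hfy.le) hpos.le) (div_nonneg hfx.le hpos.le) hab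
      refine ⟨_, ⟨h1, ?_⟩, h2⟩
      rw [edgeDefect_convexComb _ _ _ hab, ← hf]
      field_simp; ring
  rw [h1, h2, h3, Set.ncard_union_add_ncard_inter _ _ (hfin _) (hfin _), Set.ncard_union_eq _
    ((hfin _).image _) ((hfin _).image _), Set.ncard_image_of_injective _ List.cons_injective,
    Set.ncard_image_of_injective _ List.cons_injective]
  rw [Set.disjoint_left]
  rintro _ ⟨_, _, rfl⟩ ⟨_, _, h⟩
  simp at h

end Contraction

/-! ### The characteristic polynomial -/

/-- A polynomial counting the proper potentials modulo all large `q`, whose value at `-1` is, up to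
sign, the number of sign patterns. -/
theorem exists_charPoly {V : Type} [Fintype V] (E : List (V × V × ℤ)) :
    ∃ p : ℤ[X], (∀ᶠ q : ℕ in atTop, ((avoidSet (ZMod q) E).ncard : ℤ) = p.eval (q : ℤ)) ∧
      ((signPattern E '' avoidSet ℝ E).ncard : ℤ) =
        (-1) ^ Fintype.card V * p.eval (-1) := by
  classical
  induction hl : E.length generalizing V with
  | zero =>
    obtain rfl := List.length_eq_zero_iff.1 hl
    refine ⟨X ^ Fintype.card V, ?_, ?_⟩
    · filter_upwards [eventually_ne_atTop 0] with q hq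
      have := NeZero.mk hq
      simp [avoidSet, Set.ncard_univ, Nat.card_eq_fintype_card, ZMod.card]
    · have : signPattern ([] : List (V × V × ℤ)) '' avoidSet ℝ [] = {[]} := by
        ext s
        simp [avoidSet, signPattern, eq_comm]
      rw [this]
      simp [← mul_pow]
  | succ n ih =>
    obtain ⟨⟨i, j, g⟩, E, rfl⟩ := List.exists_of_length_succ _ hl
    have hE : E.length = n := by simpa using hl
    obtain ⟨p, hp1, hp2⟩ := ih E hE
    -- Contraction can create loops. A loop has constant defect `-g`: it excludes everything if `g =
    -- 0`, and nothing over `ℝ` or modulo `q > |g|` otherwise.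
    by_cases hij : i = j
    · subst hij
      have hd : ∀ (R : Type) [CommRing R] (x : V → R), edgeDefect (i, i, g) x = -(g : R) := by
        intro R _ x; simp [edgeDefect]
      by_cases hg : g = 0
      · subst hg
        have : ∀ (R : Type) [CommRing R], avoidSet R ((i, i, 0) :: E) = ∅ := by
          intro R _
          ext x
          simp only [Set.mem_empty_iff_false, iff_false]
          exact fun h => h _ List.mem_cons_self (by simp [hd])
        exact ⟨0, by simp [this], by simp [this]⟩
      · refine ⟨p, ?_, ?_⟩
        · filter_upwards [hp1, eventually_gt_atTop g.natAbs] with q hq1 hq2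
          rw [← hq1]
          have : (g : ZMod q) ≠ 0 := by
            rw [Ne, ZMod.intCast_zmod_eq_zero_iff_dvd]
            intro h
            exact hg (Int.eq_zero_of_abs_lt_dvd h (by rw [Int.abs_eq_natAbs]; omega))
          congr 2
          ext x
          simp [avoidSet, hd, this]
        · rw [← hp2]
          have h1 : avoidSet ℝ ((i, i, g) :: E) = avoidSet ℝ E := by
            ext x
            simp [avoidSet, hd, hg]
          have h2 : signPattern ((i, i, g) :: E) =
              List.cons (decide (0 < -(g : ℝ))) ∘ signPattern E := by
            ext1 x
            simp [signPattern, hd]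
          rw [h1, h2, Set.image_comp, Set.ncard_image_of_injective _ List.cons_injective]
    · obtain ⟨p', hp1', hp2'⟩ := ih (E.map (contractEdge hij g)) (by simpa using hE)
      refine ⟨p - p', ?_, ?_⟩
      · filter_upwards [hp1, hp1', eventually_ne_atTop 0] with q h1 h2 hq
        have := NeZero.mk hq
        rw [eval_sub, ← h1, ← h2, ncard_avoidSet_deletion hij g E]
        push_cast
        ring
      · rw [ncard_signPatterns_deletion hij, Nat.cast_add, hp2, hp2', eval_sub]
        have hc : Fintype.card V = Fintype.card {v : V // v ≠ j} + 1 := by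
          have : 0 < Fintype.card V := Fintype.card_pos_iff.2 ⟨j⟩
          rw [Fintype.card_subtype_compl, Fintype.card_subtype_eq]
          omega
        rw [hc]
        ring

/-! ### Regions as sign patterns -/

theorem isPreconnected_signPattern_fiber {V : Type} (E : List (V × V × ℤ)) (x : V → ℝ) :
    IsPreconnected {y | y ∈ avoidSet ℝ E ∧ signPattern E y = signPattern E x} := by
  refine Convex.isPreconnected ?_
  rintro y ⟨hy, hyx⟩ z ⟨hz, hzx⟩ a b ha hb hab
  obtain ⟨h1, h2⟩ := convexComb_mem_avoidSet hy hz (hyx.trans hzx.symm) ha hb hab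
  exact ⟨h1, h2.trans hyx⟩

/-- The pattern is locally constant, and its fibres are convex. -/
theorem connectedComponents_coe_eq_iff_signPattern {V : Type} (E : List (V × V × ℤ))
    (x y : avoidSet ℝ E) :
    (x : ConnectedComponents (avoidSet ℝ E)) = y ↔
      signPattern E x.1 = signPattern E y.1 := by
  constructor
  · intro h
    have hloc : IsLocallyConstant fun z : avoidSet ℝ E => signPattern E z.1 := by
      rw [IsLocallyConstant.iff_eventually_eq]
      intro z
      have := (continuous_subtype_val (p := (· ∈ avoidSet ℝ E))).tendsto z
      exact (this.eventually (eventually_signPattern_eq E z.2)).mono fun w hw => hw.2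
    rw [ConnectedComponents.coe_eq_coe'] at h
    exact hloc.apply_eq_of_isPreconnected isPreconnected_connectedComponent h
      mem_connectedComponent
  · intro h
    have hp := isPreconnected_signPattern_fiber E y.1
    have hp' : IsPreconnected {z : avoidSet ℝ E | signPattern E z.1 = signPattern E y.1} := by
      rw [← Topology.IsInducing.subtypeVal.isPreconnected_image]
      convert hp using 1
      ext z
      simp [and_comm]
    rw [ConnectedComponents.coe_eq_coe']
    exact hp'.subset_connectedComponent rfl h

theorem card_connectedComponents_avoidSet {V : Type} (E : List (V × V × ℤ)) :
    Finite (ConnectedComponents (avoidSet ℝ E)) ∧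
      Nat.card (ConnectedComponents (avoidSet ℝ E)) =
        (signPattern E '' avoidSet ℝ E).ncard := by
  let φ : ConnectedComponents (avoidSet ℝ E) → (signPattern E '' avoidSet ℝ E) :=
    Quotient.lift (fun x : avoidSet ℝ E => ⟨signPattern E x.1, x.1, x.2, rfl⟩)
      fun x y h => Subtype.ext <|
        (connectedComponents_coe_eq_iff_signPattern E x y).1 (Quotient.sound h)
  have hφ : Function.Bijective φ := by
    constructor
    · intro x y
      induction x using Quotient.inductionOn
      induction y using Quotient.inductionOn
      intro h
      exact (connectedComponents_coe_eq_iff_signPattern E _ _).2 (congrArg Subtype.val h)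
    · rintro ⟨_, x, hx, rfl⟩
      exact ⟨ConnectedComponents.mk ⟨x, hx⟩, rfl⟩
  have := (finite_signPatterns E (avoidSet ℝ E)).to_subtype
  exact ⟨Finite.of_injective φ hφ.1, Nat.card_congr (Equiv.ofBijective φ hφ)⟩

/-! ### Edges of the complete gain graph and rotation -/

/-- The edges of `K_n^{ab}`. -/
noncomputable def completeEdges (n : ℕ) (a b : ℤ) : List (Fin n × Fin n × ℤ) :=
  ((Finset.univ ×ˢ Finset.univ ×ˢ Finset.Icc a b).filter
    fun e : Fin n × Fin n × ℤ => e.1 < e.2.1).toList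

theorem mem_completeEdges {n : ℕ} {a b : ℤ} {e : Fin n × Fin n × ℤ} :
    e ∈ completeEdges n a b ↔ e.1 < e.2.1 ∧ a ≤ e.2.2 ∧ e.2.2 ≤ b := by
  simp [completeEdges, and_comm]

theorem compl_sUnion_arrangement (n : ℕ) (a b : ℤ) :
    (⋃₀ (completeGainGraph n a b).arrangement)ᶜ = avoidSet ℝ (completeEdges n a b) := by
  ext x
  rw [Set.mem_compl_iff, not_iff_comm]
  simp only [avoidSet, Set.mem_ofPred_eq, Set.mem_sUnion, not_forall, not_not]
  constructor
  · rintro ⟨⟨i, j, g⟩, he, h⟩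
    have he' := mem_completeEdges.1 he
    exact ⟨_, ⟨i, j, g, he'.1, ⟨⟨⟨i, j, g⟩, he'⟩, Or.inl ⟨rfl, rfl, rfl⟩⟩, rfl⟩, sub_eq_zero.1 h⟩
  · rintro ⟨_, ⟨i, j, g, hij, ⟨⟨⟨i', j', g'⟩, he⟩, h⟩, rfl⟩, hx⟩
    rcases h with ⟨rfl, rfl, rfl⟩ | ⟨rfl, rfl, -⟩
    · exact ⟨_, mem_completeEdges.2 he, sub_eq_zero.2 hx⟩
    · exact absurd hij he.1.not_gt

/-- Each orbit of the translations by constants contains exactly one potential vanishing at `l`. -/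
theorem ncard_eq_mul_ncard_normalized {V : Type} (q : ℕ) (l : V)
    {S : Set (V → ZMod q)} (hS : ∀ x ∈ S, ∀ c, (fun v => x v + c) ∈ S) :
    S.ncard = q * {x | x ∈ S ∧ x l = 0}.ncard := by
  let e : S ≃ ZMod q × {x | x ∈ S ∧ x l = 0} :=
    { toFun := fun x => (x.1 l, ⟨fun v => x.1 v + -x.1 l, hS _ x.2 _, by simp⟩)
      invFun := fun y => ⟨fun v => y.2.1 v + y.1, hS _ y.2.2.1 _⟩
      left_inv := fun x => by simp
      right_inv := fun ⟨c, x, hx, h0⟩ => by simp [h0] }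
  rw [← Nat.card_coe_set_eq, Nat.card_congr e, Nat.card_prod, Nat.card_zmod,
    Nat.card_coe_set_eq]

/-! ### Ranking labels by position -/

/-- The order on labels by increasing position, ties being broken by decreasing label. -/
def Precedes {n : ℕ} (z : Fin n → ℤ) (j i : Fin n) : Prop :=
  z j < z i ∨ (z j = z i ∧ i < j)

open Classical in
/-- The number of labels preceding `i`. -/
noncomputable def precedingCount {n : ℕ} (z : Fin n → ℤ) (i : Fin n) : ℕ :=
  (Finset.univ.filter fun j => Precedes z j i).card

section Precedes

variable {n : ℕ} {z w : Fin n → ℤ} {i j k : Fin n}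

theorem Precedes.trans (h : Precedes z i j) (h' : Precedes z j k) : Precedes z i k := by
  unfold Precedes at *; omega

theorem not_precedes_self : ¬ Precedes z i i := by
  unfold Precedes; omega

theorem Precedes.le (h : Precedes z i j) : z i ≤ z j := by
  unfold Precedes at h; omega

theorem precedes_trichotomy (z : Fin n → ℤ) (i j : Fin n) :
    Precedes z i j ∨ i = j ∨ Precedes z j i := by
  unfold Precedes; omega

theorem Precedes.count_lt (h : Precedes z j i) : precedingCount z j < precedingCount z i := by
  refine Finset.card_lt_card ((Finset.ssubset_iff_of_subset ?_).2 ⟨j, ?_, ?_⟩)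
  · intro k hk
    simp only [Finset.mem_filter, Finset.mem_univ, true_and] at hk ⊢
    exact hk.trans h
  · simpa using h
  · simpa using not_precedes_self

theorem precedingCount_lt (z : Fin n → ℤ) (i : Fin n) : precedingCount z i < n := by
  have h : precedingCount z i < (Finset.univ : Finset (Fin n)).card := by
    refine Finset.card_lt_card ((Finset.ssubset_iff_of_subset (Finset.subset_univ _)).2
      ⟨i, Finset.mem_univ _, ?_⟩)
    simpa using not_precedes_self
  simpa using h

/-- Both orders are total, so an implication between them is an equivalence. -/
theorem precedingCount_eq_of_forall (h : ∀ i j, Precedes z j i → Precedes w j i) :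
    precedingCount w = precedingCount z := by
  ext i
  unfold precedingCount
  congr 1
  ext j
  simp only [Finset.mem_filter, Finset.mem_univ, true_and]
  refine ⟨fun hw => ?_, h i j⟩
  rcases precedes_trichotomy z j i with h1 | rfl | h1
  · exact h1
  · exact absurd hw not_precedes_self
  · exact absurd (hw.trans (h _ _ h1)) not_precedes_self

theorem exists_predecessor (h : Precedes z j i) :
    ∃ k, Precedes z k i ∧ (∀ l, Precedes z l i → l = k ∨ Precedes z l k) ∧
      precedingCount z i = precedingCount z k + 1 := by
  classical
  obtain ⟨k, hk, hmax⟩ := Finset.exists_max_image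
    (Finset.univ.filter fun l => Precedes z l i) (precedingCount z) ⟨j, by simpa using h⟩
  simp only [Finset.mem_filter, Finset.mem_univ, true_and] at hk hmax
  have hk' : ∀ l, Precedes z l i → l = k ∨ Precedes z l k := by
    intro l hl
    rcases precedes_trichotomy z l k with h1 | h1 | h1
    · exact Or.inr h1
    · exact Or.inl h1
    · exact absurd (hmax l hl) h1.count_lt.not_ge
  refine ⟨k, hk, hk', ?_⟩
  have : (Finset.univ.filter fun l => Precedes z l i) =
      insert k (Finset.univ.filter fun l => Precedes z l k) := by
    ext l
    simp only [Finset.mem_filter, Finset.mem_univ, true_and, Finset.mem_insert]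
    refine ⟨hk' l, ?_⟩
    rintro (rfl | h1)
    · exact hk
    · exact h1.trans hk
  have hc := congrArg Finset.card this
  rw [Finset.card_insert_of_notMem (by simpa using not_precedes_self)] at hc
  unfold precedingCount
  convert hc

end Precedes

/-! ### Compressing the gaps -/

/-- Integral positions, with the last label at `0`, that are separated as required by the
hyperplanes with gains in `[c - b, b]` around a cycle of length `q`. -/
def separatedPositions (m : ℕ) (b c q : ℤ) : Set (Fin (m + 1) → ℤ) :=
  {y | y (Fin.last m) = 0 ∧ (∀ i, 0 ≤ y i ∧ y i < q - b) ∧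
    ∀ i j, i < j → y j - y i < c - b ∨ b < y j - y i}

/-- Positions in `[0, M)`, with the last label at `0`, that are distinct if `c = 0`. -/
def boxPositions (m : ℕ) (c M : ℤ) : Set (Fin (m + 1) → ℤ) :=
  {z | z (Fin.last m) = 0 ∧ (∀ i, 0 ≤ z i ∧ z i < M) ∧ (c = 0 → Function.Injective z)}

theorem last_precedes {m : ℕ} {z : Fin (m + 1) → ℤ} (h0 : z (Fin.last m) = 0)
    (hz : ∀ i, 0 ≤ z i) (i : Fin (m + 1)) : i = Fin.last m ∨ Precedes z (Fin.last m) i := by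
  have := hz i
  have := Fin.le_last i
  rw [Fin.le_iff_val_le_val] at this
  unfold Precedes
  rw [Fin.ext_iff, Fin.lt_def]
  omega

theorem precedingCount_last {m : ℕ} {z : Fin (m + 1) → ℤ} (h0 : z (Fin.last m) = 0)
    (hz : ∀ i, 0 ≤ z i) : precedingCount z (Fin.last m) = 0 := by
  classical
  unfold precedingCount
  rw [Finset.card_eq_zero, Finset.filter_eq_empty_iff]
  intro j _ hj
  rcases last_precedes h0 hz j with rfl | h
  · exact not_precedes_self hj
  · exact not_precedes_self (h.trans hj)

section Compress

variable {m : ℕ} {b c q : ℤ}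

/-- Between consecutive labels `k`, `i` the compression removes exactly `b`. If `k < i` the gap
exceeded `b` and stays positive; if `i < k` it exceeded `b - c`, so it can vanish only for `c = 1`,
and the tie rule then keeps the order. Induction on rank extends this to all pairs. -/
theorem precedes_compress (hcb : c ≤ b) (hc0 : 0 ≤ c) (hc1 : c ≤ 1) {y : Fin (m + 1) → ℤ}
    (hy : y ∈ separatedPositions m b c q) {i j : Fin (m + 1)} (h : Precedes y j i) :
    Precedes (fun i => y i - b * precedingCount y i) j i ∧
      (c = 0 → y j - b * precedingCount y j < y i - b * precedingCount y i) := by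
  induction hr : precedingCount y i using Nat.strong_induction_on generalizing i with
  | _ r ih =>
    obtain ⟨k, hki, hk, hcount⟩ := exists_predecessor h
    have step : Precedes (fun i => y i - b * precedingCount y i) k i ∧
        (c = 0 → y k - b * precedingCount y k < y i - b * precedingCount y i) := by
      have hci : b * (precedingCount y i : ℤ) = b * precedingCount y k + b := by
        rw [hcount]; push_cast; ring
      have hle := hki.le
      have hs1 := hy.2.2 i k
      have hs2 := hy.2.2 k i
      have hne : k ≠ i := fun h => not_precedes_self (h ▸ hki)
      have hlt : k < i ∨ i < k := lt_or_gt_of_ne hne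
      unfold Precedes
      simp only [hci]
      rcases hlt with hlt | hlt
      · have := hs2 hlt
        omega
      · have := hs1 hlt
        omega
    rw [← hr]
    rcases hk j h with rfl | hjk
    · exact step
    · obtain ⟨h1, h2⟩ := ih _ (hr ▸ hki.count_lt) hjk rfl
      exact ⟨h1.trans step.1, fun hc => (h2 hc).trans (step.2 hc)⟩

theorem compress_mem (hcb : c ≤ b) (hc0 : 0 ≤ c) (hc1 : c ≤ 1) {y : Fin (m + 1) → ℤ}
    (hy : y ∈ separatedPositions m b c q) :
    (fun i => y i - b * precedingCount y i) ∈ boxPositions m c (q - b * (m + 1)) := by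
  have h0 : y (Fin.last m) - b * precedingCount y (Fin.last m) = 0 := by
    rw [precedingCount_last hy.1 fun i => (hy.2.1 i).1, hy.1]; simp
  refine ⟨h0, fun i => ⟨?_, ?_⟩, fun hc => ?_⟩
  · rcases last_precedes hy.1 (fun i => (hy.2.1 i).1) i with rfl | h
    · exact h0.ge
    · exact h0.ge.trans (precedes_compress hcb hc0 hc1 hy h).1.le
  · obtain ⟨k, -, hk⟩ := Finset.exists_max_image Finset.univ (precedingCount y)
      Finset.univ_nonempty
    have hk' : ∀ j, j = k ∨ Precedes y j k := by
      intro j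
      rcases precedes_trichotomy y j k with h1 | h1 | h1
      · exact Or.inr h1
      · exact Or.inl h1
      · exact absurd (hk j (Finset.mem_univ _)) h1.count_lt.not_ge
    have hcount : precedingCount y k = m := by
      classical
      have : (Finset.univ.filter fun j => Precedes y j k) = Finset.univ.erase k := by
        ext j
        simp only [Finset.mem_filter, Finset.mem_univ, true_and, Finset.mem_erase, and_true]
        refine ⟨?_, fun h => (hk' j).resolve_left h⟩
        rintro h rfl
        exact not_precedes_self h
      have h := congrArg Finset.card this
      rw [Finset.card_erase_of_mem (Finset.mem_univ _), Finset.card_univ, Fintype.card_fin,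
        Nat.add_sub_cancel] at h
      unfold precedingCount
      convert h
    have hle : y i - b * precedingCount y i ≤ y k - b * precedingCount y k := by
      rcases hk' i with rfl | h
      · exact le_rfl
      · exact (precedes_compress hcb hc0 hc1 hy h).1.le
    have := (hy.2.1 k).2
    rw [hcount] at hle
    show y i - b * precedingCount y i < _
    linarith
  · intro i j hij
    rcases precedes_trichotomy y i j with h | h | h
    · exact absurd hij ((precedes_compress hcb hc0 hc1 hy h).2 hc).ne
    · exact h
    · exact absurd hij ((precedes_compress hcb hc0 hc1 hy h).2 hc).ne'

theorem expand_gap (hb : 0 ≤ b) {z : Fin (m + 1) → ℤ} {i j : Fin (m + 1)}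
    (h : Precedes z j i) :
    z i - z j + b ≤ (z i + b * precedingCount z i) - (z j + b * precedingCount z j) := by
  have h1 : (precedingCount z j : ℤ) + 1 ≤ precedingCount z i := by exact_mod_cast h.count_lt
  have := mul_le_mul_of_nonneg_left h1 hb
  linarith

theorem precedes_expand (hb : 0 ≤ b) {z : Fin (m + 1) → ℤ} {i j : Fin (m + 1)}
    (h : Precedes z j i) : Precedes (fun i => z i + b * precedingCount z i) j i := by
  have h1 := expand_gap hb h
  unfold Precedes at *
  simp only
  generalize b * (precedingCount z i : ℤ) = u at *
  generalize b * (precedingCount z j : ℤ) = v at *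
  omega

theorem expand_mem (hb : 0 ≤ b) (hc0 : 0 ≤ c) (hc1 : c ≤ 1) {z : Fin (m + 1) → ℤ}
    (hz : z ∈ boxPositions m c (q - b * (m + 1))) :
    (fun i => z i + b * precedingCount z i) ∈ separatedPositions m b c q := by
  refine ⟨?_, fun i => ⟨?_, ?_⟩, fun i j hij => ?_⟩
  · simp only
    rw [precedingCount_last hz.1 fun i => (hz.2.1 i).1, hz.1]; simp
  · have := (hz.2.1 i).1
    positivity
  · have h1 : (precedingCount z i : ℤ) ≤ m := by
      exact_mod_cast Nat.lt_succ_iff.1 (precedingCount_lt z i)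
    have := mul_le_mul_of_nonneg_left h1 hb
    have := (hz.2.1 i).2
    show z i + b * precedingCount z i < _
    linarith
  · simp only
    rcases precedes_trichotomy z i j with h | h | h
    · have h1 := expand_gap hb h
      unfold Precedes at h
      right
      have : z i < z j := by omega
      linarith
    · exact absurd h hij.ne
    · have h1 := expand_gap hb h
      have h2 := h.le
      left
      rcases (by omega : c = 0 ∨ c = 1) with rfl | rfl
      · have : z j ≠ z i := fun h => hij.ne (hz.2.2 rfl h).symm
        have : z j < z i := lt_of_le_of_ne h2 this
        linarith
      · linarith

/-- Compression and expansion preserve the order, hence the ranks, so they are mutually inverse. -/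
theorem ncard_separatedPositions (hcb : c ≤ b) (hc0 : 0 ≤ c) (hc1 : c ≤ 1) :
    (separatedPositions m b c q).ncard = (boxPositions m c (q - b * (m + 1))).ncard := by
  have hb : 0 ≤ b := hc0.trans hcb
  refine Set.ncard_congr (fun y _ i => y i - b * precedingCount y i)
    (fun y hy => compress_mem hcb hc0 hc1 hy) ?_ ?_
  · intro y y' hy hy' h
    have e1 := precedingCount_eq_of_forall fun i j h =>
      (precedes_compress hcb hc0 hc1 hy (i := i) (j := j) h).1
    have e2 := precedingCount_eq_of_forall fun i j h =>
      (precedes_compress hcb hc0 hc1 hy' (i := i) (j := j) h).1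
    rw [h, e2] at e1
    ext i
    have := congrFun h i
    simp only [e1] at this
    exact sub_left_injective this
  · intro z hz
    refine ⟨_, expand_mem hb hc0 hc1 hz, ?_⟩
    ext i
    rw [precedingCount_eq_of_forall fun i j h => precedes_expand hb (i := i) (j := j) h]
    ring

end Compress

/-! ### From residues to integer positions -/

theorem intCast_zmod_inj_of_mem {q : ℕ} {u v : ℤ} (hu : 0 ≤ u ∧ u < q) (hv : 0 ≤ v ∧ v < q)
    (h : (u : ZMod q) = v) : u = v := by
  have h1 := (ZMod.intCast_eq_intCast_iff' u v q).1 h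
  rwa [Int.emod_eq_of_lt hu.1 hu.2, Int.emod_eq_of_lt hv.1 hv.2] at h1

theorem ncard_normalized_avoidSet {m q : ℕ} [NeZero q] {b c : ℤ} (hc0 : 0 ≤ c)
    (hcb : c ≤ b) (hq : b < q) :
    {x | x ∈ avoidSet (ZMod q) (completeEdges (m + 1) (c - b) b) ∧ x (Fin.last m) = 0}.ncard =
      (separatedPositions m b c q).ncard := by
  symm
  refine Set.ncard_congr (fun y _ i => (y i : ZMod q)) ?_ ?_ ?_
  · rintro y ⟨h0, hr, hs⟩
    refine ⟨?_, by simp [h0]⟩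
    rintro ⟨i, j, g⟩ he h
    obtain ⟨hij, hg1, hg2⟩ := mem_completeEdges.1 he
    simp only at hij hg1 hg2
    have h' : ((y j - y i - g : ℤ) : ZMod q) = 0 := by
      push_cast; exact h
    rw [ZMod.intCast_zmod_eq_zero_iff_dvd] at h'
    have := hr i
    have := hr j
    -- The bound `q - b` on positions keeps the defect strictly between `-q` and `q`, so no
    -- wrap-around occurs.
    have hz := Int.eq_zero_of_abs_lt_dvd h' (by rw [abs_lt]; omega)
    have := hs i j hij
    omega
  · rintro y y' ⟨-, hr, -⟩ ⟨-, hr', -⟩ h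
    ext i
    have := hr i
    have := hr' i
    exact intCast_zmod_inj_of_mem (by omega) (by omega) (congrFun h i)
  · rintro x ⟨hx, h0⟩
    have hcast : ∀ i, (((x i).val : ℤ) : ZMod q) = x i := fun i => by simp
    refine ⟨fun i => ((x i).val : ℤ), ⟨by simp [h0], fun i => ⟨by positivity, ?_⟩, ?_⟩,
      funext hcast⟩
    -- A position at or beyond `q - b` would violate the edge to the last label, seen at `q` instead
    -- of 0, with gain `q - x i` between 1 and `b`.
    · by_contra hcon
      simp only [not_lt] at hcon
      have hlt : ((x i).val : ℤ) < q := by exact_mod_cast ZMod.val_lt (x i)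
      rcases (Fin.le_last i).eq_or_lt with rfl | hi
      · simp only [h0, ZMod.val_zero] at hcon
        push_cast at hcon
        omega
      · refine hx (i, Fin.last m, q - (x i).val) (mem_completeEdges.2 ⟨hi, ?_, ?_⟩) ?_
        · simp only; omega
        · simp only; omega
        · simp only [edgeDefect, h0]
          rw [Int.cast_sub, hcast]
          simp
    · intro i j hij
      by_contra hcon
      simp only at hcon
      refine hx (i, j, (x j).val - (x i).val) (mem_completeEdges.2 ⟨hij, ?_, ?_⟩) ?_
      · simp only; omega
      · simp only; omega
      · simp only [edgeDefect]
        rw [Int.cast_sub, hcast, hcast]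
        simp

theorem ncard_normalized_boxes {m M : ℕ} [NeZero M] {c : ℤ} :
    {x : Fin (m + 1) → ZMod M | x ∈ {x | c = 0 → Function.Injective x} ∧
      x (Fin.last m) = 0}.ncard = (boxPositions m c M).ncard := by
  symm
  refine Set.ncard_congr (fun y _ i => (y i : ZMod M)) ?_ ?_ ?_
  · rintro y ⟨h0, hr, hs⟩
    exact ⟨fun hc i j h => hs hc (intCast_zmod_inj_of_mem (hr i) (hr j) h), by simp [h0]⟩
  · rintro y y' ⟨-, hr, -⟩ ⟨-, hr', -⟩ h
    ext i
    exact intCast_zmod_inj_of_mem (hr i) (hr' i) (congrFun h i)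
  · rintro x ⟨hx, h0⟩
    refine ⟨fun i => ((x i).val : ℤ), ⟨by simp [h0], fun i => ⟨by positivity, ?_⟩, ?_⟩,
      funext fun i => by simp⟩
    · exact Int.ofNat_lt.2 (ZMod.val_lt (x i))
    · intro hc i j h
      exact hx hc (ZMod.val_injective M (Int.ofNat_inj.1 h))

theorem ncard_avoidSet_completeEdges {m q M : ℕ} {b c : ℤ} (hc0 : 0 ≤ c) (hc1 : c ≤ 1)
    (hcb : c ≤ b) (hM : 0 < M) (hq : (q : ℤ) = M + b * (m + 1)) :
    (avoidSet (ZMod q) (completeEdges (m + 1) (c - b) b)).ncard * M =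
      q * {x : Fin (m + 1) → ZMod M | c = 0 → Function.Injective x}.ncard := by
  have hb : 0 ≤ b := hc0.trans hcb
  have hbq : b < q := by
    have : 0 ≤ b * m := by positivity
    rw [mul_add, mul_one] at hq
    omega
  have : NeZero q := ⟨by omega⟩
  have : NeZero M := ⟨hM.ne'⟩
  rw [ncard_eq_mul_ncard_normalized q (Fin.last m), ncard_normalized_avoidSet hc0 hcb hbq,
    ncard_separatedPositions hcb hc0 hc1, ncard_eq_mul_ncard_normalized M (Fin.last m),
    ncard_normalized_boxes, hq, add_sub_cancel_right]
  · ring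
  · intro x hx d hc i j h
    exact hx hc (add_right_cancel h)
  · intro x hx d e he
    simpa [edgeDefect] using hx e he

/-! ### Evaluation at `-1` -/

theorem polynomial_eq_of_eventually {p r : ℤ[X]}
    (h : ∀ᶠ q : ℕ in atTop, p.eval (q : ℤ) = r.eval (q : ℤ)) : p = r := by
  refine Polynomial.eq_of_infinite_eval_eq p r ?_
  obtain ⟨N, hN⟩ := eventually_atTop.1 h
  refine Set.infinite_of_injective_forall_mem (f := fun k : ℕ => ((N + k : ℕ) : ℤ)) ?_ ?_
  · intro k l hkl
    simpa using hkl
  · intro k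
    exact hN _ (Nat.le_add_right _ _)

/-- The number of sign patterns of `K_{m+1}^{c-b,b}`, from a polynomial `u` counting the arrangements
of the labels in boxes. -/
theorem ncard_signPatterns_completeEdges {m : ℕ} {b c : ℤ} (hc0 : 0 ≤ c) (hc1 : c ≤ 1)
    (hcb : c ≤ b) (u : ℤ[X])
    (hu : ∀ M : ℕ, 0 < M →
      ({x : Fin (m + 1) → ZMod M | c = 0 → Function.Injective x}.ncard : ℤ) =
        u.eval (M : ℤ)) :
    ((signPattern (completeEdges (m + 1) (c - b) b) ''
      avoidSet ℝ (completeEdges (m + 1) (c - b) b)).ncard : ℤ) * (b * (m + 1) + 1) =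
        (-1) ^ (m + 1) * u.eval (-(b * (m + 1) + 1)) := by
  obtain ⟨p, hp1, hp2⟩ := exists_charPoly (completeEdges (m + 1) (c - b) b)
  -- This is `p(q) M = q u(M)` with `M = q - b(m + 1)`, valid for all large `q` and hence as
  -- polynomials.
  have hpoly : p * (X - C (b * (m + 1))) = X * u.comp (X - C (b * (m + 1))) := by
    refine polynomial_eq_of_eventually ?_
    filter_upwards [hp1, eventually_gt_atTop (b * (m + 1)).toNat] with q h1 h2
    obtain ⟨M, hM⟩ := Int.eq_ofNat_of_zero_le (a := q - b * (m + 1)) (by omega)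
    have h3 := ncard_avoidSet_completeEdges (m := m) (q := q) (M := M) hc0 hc1 hcb (by omega)
      (by omega)
    simp only [eval_mul, eval_sub, eval_X, eval_C, eval_comp]
    rw [← h1, hM, ← hu M (by omega)]
    exact_mod_cast h3
  have h := congrArg (Polynomial.eval (-1)) hpoly
  simp only [eval_mul, eval_sub, eval_X, eval_C, eval_comp] at h
  rw [hp2, Fintype.card_fin, show -(b * ((m : ℤ) + 1) + 1) = -1 - b * (m + 1) by ring]
  linear_combination (-(-1 : ℤ) ^ (m + 1)) * h

theorem ncard_signPatterns_catalan {m : ℕ} {b : ℤ} (hb : 0 ≤ b) :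
    ((signPattern (completeEdges (m + 1) (-b) b) ''
      avoidSet ℝ (completeEdges (m + 1) (-b) b)).ncard : ℤ) =
        ∏ i ∈ Finset.Icc 2 (m + 1), (b * (m + 1) + (i : ℤ)) := by
  have h := ncard_signPatterns_completeEdges (m := m) le_rfl zero_le_one hb
    (∏ k ∈ Finset.range (m + 1), (X - C (k : ℤ))) ?_
  · have hne : b * ((m : ℤ) + 1) + 1 ≠ 0 := by positivity
    rw [zero_sub] at h
    refine mul_right_cancel₀ hne (h.trans ?_)
    rw [eval_prod]
    have h1 : ∏ k ∈ Finset.range (m + 1),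
        eval (-(b * ((m : ℤ) + 1) + 1)) (X - C (k : ℤ)) =
        (-1) ^ (m + 1) * ∏ k ∈ Finset.range (m + 1), (b * (m + 1) + ((k + 1 : ℕ) : ℤ)) := by
      rw [← Finset.card_range (m + 1), ← Finset.prod_const, Finset.card_range,
        ← Finset.prod_mul_distrib]
      refine Finset.prod_congr rfl fun k _ => ?_
      simp only [eval_sub, eval_X, eval_C]
      push_cast
      ring
    -- The factor at `k = 0` is the `b(m + 1) + 1` being cancelled, so the product starts at 2.
    rw [h1, ← mul_assoc, ← mul_pow, neg_one_mul, neg_neg, one_pow, one_mul,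
      Finset.prod_range_succ']
    congr 1
    rw [Finset.range_eq_Ico]
    exact Finset.prod_Ico_add' (fun i : ℕ => b * ((m : ℤ) + 1) + (i : ℤ)) 0 m 2
  · intro M hM
    have : NeZero M := ⟨hM.ne'⟩
    simp only [forall_const]
    have hcard : Nat.card {x : Fin (m + 1) → ZMod M | Function.Injective x} =
        Nat.card (Fin (m + 1) ↪ ZMod M) :=
      Nat.card_congr (Equiv.subtypeInjectiveEquivEmbedding (Fin (m + 1)) (ZMod M))
    rw [← Nat.card_coe_set_eq, hcard, Nat.card_eq_fintype_card, Fintype.card_embedding_eq, ZMod.card, Fintype.card_fin,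
      ← descPochhammer_eval_eq_descFactorial ℤ, descPochhammer_eval_eq_prod_range, eval_prod]
    simp

theorem ncard_signPatterns_shi {m : ℕ} {b : ℤ} (hb : 0 ≤ b) :
    ((signPattern (completeEdges (m + 1) (1 - b) b) ''
      avoidSet ℝ (completeEdges (m + 1) (1 - b) b)).ncard : ℤ) = (b * (m + 1) + 1) ^ m := by
  -- For `b = 0` the condition `c ≤ b` fails with `c = 1`, but the arrangement is empty and has one
  -- region.
  rcases hb.eq_or_lt with rfl | hb
  · have : completeEdges (m + 1) (1 - 0) 0 = [] := by
      rw [List.eq_nil_iff_forall_not_mem]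
      intro e he
      have := mem_completeEdges.1 he
      omega
    have h2 : signPattern ([] : List (Fin (m + 1) × Fin (m + 1) × ℤ)) '' avoidSet ℝ [] =
        {[]} := by
      ext s
      simp [avoidSet, signPattern, eq_comm]
    rw [this, h2]
    simp
  · have h := ncard_signPatterns_completeEdges (m := m) (b := b) zero_le_one le_rfl hb
      (X ^ (m + 1)) ?_
    · have hne : b * ((m : ℤ) + 1) + 1 ≠ 0 := by positivity
      refine mul_right_cancel₀ hne (h.trans ?_)
      rw [eval_pow, eval_X, ← mul_pow, ← pow_succ]
      ring
    · intro M hM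
      have : NeZero M := ⟨hM.ne'⟩
      simp [Set.ncard_univ, Nat.card_eq_fintype_card, ZMod.card]

theorem card_arrangementRegion (n : ℕ) (a b : ℤ) :
    Finite (ArrangementRegion (completeGainGraph n a b).arrangement) ∧
      Nat.card (ArrangementRegion (completeGainGraph n a b).arrangement) =
        (signPattern (completeEdges n a b) '' avoidSet ℝ (completeEdges n a b)).ncard := by
  unfold ArrangementRegion
  rw [compl_sUnion_arrangement]
  exact card_connectedComponents_avoidSet _

theorem mainTheorem3 (n : ℕ) (hn : 1 ≤ n) (a b : ℤ) (hb : 0 ≤ b) :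
    (a + b = 0 →
      Finite (ArrangementRegion (completeGainGraph n a b).arrangement) ∧
      (Nat.card (ArrangementRegion (completeGainGraph n a b).arrangement) : ℤ) =
        ∏ i ∈ Finset.Icc 2 n, (b * (n : ℤ) + (i : ℤ))) ∧
    (a + b = 1 →
      Finite (ArrangementRegion (completeGainGraph n a b).arrangement) ∧
      (Nat.card (ArrangementRegion (completeGainGraph n a b).arrangement) : ℤ) =
        (b * (n : ℤ) + 1) ^ (n - 1)) := by
  obtain ⟨hfin, hcard⟩ := card_arrangementRegion n a b
  obtain ⟨m, rfl⟩ := Nat.exists_eq_add_of_le' hn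
  refine ⟨fun hab => ⟨hfin, ?_⟩, fun hab => ⟨hfin, ?_⟩⟩
  · obtain rfl : a = -b := by omega
    rw [hcard, ncard_signPatterns_catalan hb]
    push_cast
    rfl
  · obtain rfl : a = 1 - b := by omega
    rw [hcard, ncard_signPatterns_shi hb]
    push_cast
    rfl
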